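/- Let $H(\mathbb{Z})=\langle a,b : [a,b]\text{ is central}\rangle$ be the integer Heisenberg group with its standard generating set $S=\{a,a^{-1},b,b^{-1}\}$. For $g\in H(\mathbb{Z})$ let $|g|$ be the word length of $g$ with respect to $S$, let $B_n=\{g : |g|\le n\}$ be the ball of radius $n$ about the identity, and let $$\kappa(g)=\frac{|g|-\mathrm{Av}(g)}{|g|},\qquad \mathrm{Av}(g)=\frac{1}{|S|}\sum_{s\in S}|s^{-1}gs|,$$ be the comparison (Ricci) curvature at $g$, with $\kappa(e)=0$ at the identity. **Theorem.** There is an $\epsilon>0$ such that for all sufficiently large $n$ $$\epsilon<\frac{\#\{g\in B_n : \kappa(g)=0\}}{\# B_n}<1-\epsilon,\qquad \epsilon<\frac{\#\{g\in B_n : \kappa(g)>0\}}{\# B_n}<1-\epsilon,\qquad \epsilon<\frac{\#\{g\in B_n : \kappa(g)<0\}}{\# B_n}<1-\epsilon .$$ -/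

import Mathlib

section CayleyCurvature

variable {G : Type*} [Group G]

/-- The word length `|g|` of `g` with respect to a (symmetric, generating) set `S`: the least length
of a word in the letters of `S` that represents `g`. -/
noncomputable def wordLength (S : Finset G) (g : G) : ℕ :=
  sInf {n : ℕ | ∃ w : List G, (∀ s ∈ w, s ∈ S) ∧ w.prod = g ∧ w.length = n}

/-- The ball `B_n` of radius `n` about the identity in the word metric. -/
def wordBall (S : Finset G) (n : ℕ) : Set G :=
  {g : G | wordLength S g ≤ n}

/-- `Av(g)`: the average word length of the conjugates `s⁻¹ g s`, where `s` runs over `S`. -/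
noncomputable def averageConjLength (S : Finset G) (g : G) : ℝ :=
  (∑ s ∈ S, (wordLength S (s⁻¹ * g * s) : ℝ)) / (S.card : ℝ)

/-- The comparison curvature `κ(g) = (|g| - Av(g)) / |g|` (spheres of radius one). At the identity
this is `0 / 0`, which evaluates to `0`; this agrees with the convention that the curvature vanishes
at every central element. -/
noncomputable def comparisonCurvature (S : Finset G) (g : G) : ℝ :=
  ((wordLength S g : ℝ) - averageConjLength S g) / (wordLength S g : ℝ)

/-- The proportion of the points of the ball `B_n` that satisfy `P`. -/
noncomputable def ballProportion (S : Finset G) (P : G → Prop) (n : ℕ) : ℝ :=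
  ({g : G | g ∈ wordBall S n ∧ P g}.ncard : ℝ) / ((wordBall S n).ncard : ℝ)

end CayleyCurvature

open scoped commutatorElement in
/-- The relators of `⟨a, b : [a, b] is central⟩`, namely `[a, [a, b]]` and `[b, [a, b]]`, in the free
group on `a` (the letter `0`) and `b` (the letter `1`). -/
def heisenbergRelators : Set (FreeGroup (Fin 2)) :=
  let a : FreeGroup (Fin 2) := FreeGroup.of 0
  let b : FreeGroup (Fin 2) := FreeGroup.of 1
  {⁅a, ⁅a, b⁆⁆, ⁅b, ⁅a, b⁆⁆}

/-- The integer Heisenberg group `H(ℤ) = ⟨a, b : [a, b] is central⟩`. -/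
abbrev HeisenbergGroup : Type := PresentedGroup heisenbergRelators

namespace HeisenbergGroup

/-- The standard generator `a`. -/
def a : HeisenbergGroup := PresentedGroup.of 0

/-- The standard generator `b`. -/
def b : HeisenbergGroup := PresentedGroup.of 1

open Classical in
/-- The standard generating set `{a, b}^±`. -/
noncomputable def standardGenerators : Finset HeisenbergGroup := {a, a⁻¹, b, b⁻¹}

/-- The curvature `κ` of the Heisenberg group with its standard generators. -/
noncomputable def curvature (g : HeisenbergGroup) : ℝ := comparisonCurvature standardGenerators g

end HeisenbergGroup

/-! A word is a lattice path from the origin to (x, y), and z is its integral of x dy. Write z = q x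
- r with 0 ≤ r < x. For y ≤ q ≤ x and q ≥ 1 an isoperimetric argument (`word_area_bound`,
`wordLength_eq`) gives length x - y + 2q, independent of r. Conjugating by b^±1 shifts z by ±x,
hence q by ±1, and the two length changes cancel. Conjugating by a^±1 shifts r by ±y, and the length
changes, by 2, only when r leaves [0, x). So the sign of κ is read off from r (`curvature_eq`):
negative near 0, positive near x, zero in between. Each regime contains at least m^4 elements of B_n
with m = n / 15, while #B_n = O(n^4). This gives the three lower bounds; disjointness of the regimes
gives the upper bounds. -/

/-- The integer Heisenberg group in coordinates: `z` records `∫ x dy` along a path from the origin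
to `(x, y)`. -/
@[ext] structure HeisenbergCoords where
  /-- The exponent of `a`. -/
  x : ℤ
  /-- The exponent of `b`. -/
  y : ℤ
  /-- The exponent of the central element `[a, b]`. -/
  z : ℤ

namespace HeisenbergCoords

instance : Mul HeisenbergCoords := ⟨fun g h => ⟨g.x + h.x, g.y + h.y, g.z + h.z + g.x * h.y⟩⟩
instance : One HeisenbergCoords := ⟨⟨0, 0, 0⟩⟩
instance : Inv HeisenbergCoords := ⟨fun g => ⟨-g.x, -g.y, -g.z + g.x * g.y⟩⟩

@[simp] lemma mul_x (g h : HeisenbergCoords) : (g * h).x = g.x + h.x := rfl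
@[simp] lemma mul_y (g h : HeisenbergCoords) : (g * h).y = g.y + h.y := rfl
@[simp] lemma mul_z (g h : HeisenbergCoords) : (g * h).z = g.z + h.z + g.x * h.y := rfl
@[simp] lemma one_x : (1 : HeisenbergCoords).x = 0 := rfl
@[simp] lemma one_y : (1 : HeisenbergCoords).y = 0 := rfl
@[simp] lemma one_z : (1 : HeisenbergCoords).z = 0 := rfl
@[simp] lemma inv_x (g : HeisenbergCoords) : g⁻¹.x = -g.x := rfl
@[simp] lemma inv_y (g : HeisenbergCoords) : g⁻¹.y = -g.y := rfl
@[simp] lemma inv_z (g : HeisenbergCoords) : g⁻¹.z = -g.z + g.x * g.y := rfl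

instance : Group HeisenbergCoords :=
  Group.ofLeftAxioms
    (fun g h k => by ext <;> simp <;> ring)
    (fun g => by ext <;> simp)
    (fun g => by ext <;> simp)

/-- The image of the generators in coordinates. -/
def gen (i : Fin 2) : HeisenbergCoords := if i = 0 then ⟨1, 0, 0⟩ else ⟨0, 1, 0⟩

@[simp] lemma gen_zero : gen 0 = ⟨1, 0, 0⟩ := rfl
@[simp] lemma gen_one : gen 1 = ⟨0, 1, 0⟩ := rfl

end HeisenbergCoords

/-! ### Isomorphism with the coordinate model -/

namespace HeisenbergGroup

open scoped commutatorElement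

/-- The homomorphism to coordinates given by the presentation. -/
def toCoords : HeisenbergGroup →* HeisenbergCoords :=
  PresentedGroup.toGroup (f := HeisenbergCoords.gen) (by
    intro r hr
    simp only [heisenbergRelators, Set.mem_insert_iff, Set.mem_singleton_iff] at hr
    rcases hr with rfl | rfl <;> ext <;> simp [commutatorElement_def])

@[simp] lemma toCoords_a : toCoords a = ⟨1, 0, 0⟩ := PresentedGroup.toGroup.of _
@[simp] lemma toCoords_b : toCoords b = ⟨0, 1, 0⟩ := PresentedGroup.toGroup.of _

lemma commute_a_commutator : Commute a ⁅a, b⁆ := by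
  rw [← commutatorElement_eq_one_iff_commute]
  have := PresentedGroup.one_of_mem (rels := heisenbergRelators)
    (x := ⁅(FreeGroup.of 0 : FreeGroup (Fin 2)), ⁅(FreeGroup.of 0 : FreeGroup (Fin 2)), FreeGroup.of 1⁆⁆)
    (by simp [heisenbergRelators])
  rwa [map_commutatorElement, map_commutatorElement] at this

lemma commute_b_commutator : Commute b ⁅a, b⁆ := by
  rw [← commutatorElement_eq_one_iff_commute]
  have := PresentedGroup.one_of_mem (rels := heisenbergRelators)
    (x := ⁅(FreeGroup.of 1 : FreeGroup (Fin 2)), ⁅(FreeGroup.of 0 : FreeGroup (Fin 2)), FreeGroup.of 1⁆⁆)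
    (by simp [heisenbergRelators])
  rwa [map_commutatorElement, map_commutatorElement] at this

lemma conj_a_zpow_b (x : ℤ) : a ^ x * b * (a ^ x)⁻¹ = ⁅a, b⁆ ^ x * b := by
  have hab : a * b * a⁻¹ = ⁅a, b⁆ * b := by simp [commutatorElement_def]
  have hba : a⁻¹ * b * a = ⁅a, b⁆⁻¹ * b := by
    have h := (commute_a_commutator.inv_left.inv_right).eq
    calc a⁻¹ * b * a = a⁻¹ * ⁅a, b⁆⁻¹ * (⁅a, b⁆ * b) * a := by group
      _ = ⁅a, b⁆⁻¹ * b := by rw [h, ← hab]; group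
  induction x using Int.induction_on with
  | zero => simp
  | succ n ih =>
    have hc := (commute_a_commutator.zpow_right (n : ℤ)).eq
    calc a ^ ((n : ℤ) + 1) * b * (a ^ ((n : ℤ) + 1))⁻¹
        = a * (a ^ (n : ℤ) * b * (a ^ (n : ℤ))⁻¹) * a⁻¹ := by
          rw [add_comm, zpow_add, zpow_one]; group
      _ = ⁅a, b⁆ ^ (n : ℤ) * (a * b * a⁻¹) := by
          rw [ih, ← mul_assoc, hc]; simp only [mul_assoc]
      _ = _ := by rw [hab, zpow_add, zpow_one, mul_assoc]
  | pred n ih =>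
    have hc := (commute_a_commutator.inv_left.zpow_right (-(n : ℤ))).eq
    calc a ^ (-(n : ℤ) - 1) * b * (a ^ (-(n : ℤ) - 1))⁻¹
        = a⁻¹ * (a ^ (-(n : ℤ)) * b * (a ^ (-(n : ℤ)))⁻¹) * a := by
          rw [sub_eq_neg_add, zpow_add, zpow_neg_one]; group
      _ = ⁅a, b⁆ ^ (-(n : ℤ)) * (a⁻¹ * b * a) := by
          rw [ih, ← mul_assoc, hc]; simp only [mul_assoc]
      _ = _ := by rw [hba, sub_eq_add_neg, zpow_add, zpow_neg_one, mul_assoc]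

/-- Each exchange of an a with a b costs one central commutator; this is the term `g.x * h.y` of the
product in coordinates. -/
lemma a_zpow_mul_b_zpow (x y : ℤ) : a ^ x * b ^ y = ⁅a, b⁆ ^ (x * y) * b ^ y * a ^ x := by
  have h : a ^ x * b ^ y * (a ^ x)⁻¹ = ⁅a, b⁆ ^ (x * y) * b ^ y := by
    rw [← conj_zpow, conj_a_zpow_b, ((commute_b_commutator.zpow_right x).symm).mul_zpow, zpow_mul]
  rw [← h]; group

/-- The element with given coordinates, in normal form. -/
def ofCoords : HeisenbergCoords →* HeisenbergGroup where
  toFun g := ⁅a, b⁆ ^ g.z * b ^ g.y * a ^ g.x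
  map_one' := by simp
  map_mul' g h := by
    have h1 := ((commute_a_commutator.zpow_left g.x).zpow_right h.z).eq
    have h2 := ((commute_b_commutator.zpow_left g.y).zpow_right h.z).eq
    have h3 := ((commute_b_commutator.zpow_left g.y).zpow_right (g.x * h.y)).eq
    calc ⁅a, b⁆ ^ (g.z + h.z + g.x * h.y) * b ^ (g.y + h.y) * a ^ (g.x + h.x)
        = ⁅a, b⁆ ^ g.z * ⁅a, b⁆ ^ h.z * (⁅a, b⁆ ^ (g.x * h.y) * b ^ g.y) * b ^ h.y
            * a ^ g.x * a ^ h.x := by simp only [zpow_add, mul_assoc]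
      _ = ⁅a, b⁆ ^ g.z * (⁅a, b⁆ ^ h.z * b ^ g.y) * (⁅a, b⁆ ^ (g.x * h.y) * b ^ h.y
            * a ^ g.x) * a ^ h.x := by rw [← h3]; simp only [mul_assoc]
      _ = ⁅a, b⁆ ^ g.z * b ^ g.y * (⁅a, b⁆ ^ h.z * a ^ g.x) * b ^ h.y * a ^ h.x := by
          rw [← h2, ← a_zpow_mul_b_zpow]; simp only [mul_assoc]
      _ = _ := by rw [← h1]; simp only [mul_assoc]

/-- The Heisenberg group is isomorphic to its coordinate model. -/
def coordsEquiv : HeisenbergGroup ≃* HeisenbergCoords :=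
  MonoidHom.toMulEquiv toCoords ofCoords
    (by
      apply PresentedGroup.ext
      intro i
      fin_cases i
      · change ofCoords (toCoords a) = a
        simp [ofCoords]
      · change ofCoords (toCoords b) = b
        simp [ofCoords])
    (by
      have ha (n : ℤ) : (⟨1, 0, 0⟩ : HeisenbergCoords) ^ n = ⟨n, 0, 0⟩ := by
        induction n using Int.induction_on with
        | zero => rfl
        | succ n ih => rw [zpow_add_one, ih]; ext <;> simp
        | pred n ih => rw [zpow_sub_one, ih]; ext <;> simp; ring
      have hb (n : ℤ) : (⟨0, 1, 0⟩ : HeisenbergCoords) ^ n = ⟨0, n, 0⟩ := by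
        induction n using Int.induction_on with
        | zero => rfl
        | succ n ih => rw [zpow_add_one, ih]; ext <;> simp
        | pred n ih => rw [zpow_sub_one, ih]; ext <;> simp; ring
      have hc (n : ℤ) : (⟨0, 0, 1⟩ : HeisenbergCoords) ^ n = ⟨0, 0, n⟩ := by
        induction n using Int.induction_on with
        | zero => rfl
        | succ n ih => rw [zpow_add_one, ih]; ext <;> simp
        | pred n ih => rw [zpow_sub_one, ih]; ext <;> simp; ring
      have hcomm : ⁅(⟨1, 0, 0⟩ : HeisenbergCoords), (⟨0, 1, 0⟩ : HeisenbergCoords)⁆ = ⟨0, 0, 1⟩ := by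
        ext <;> simp [commutatorElement_def]
      refine MonoidHom.ext fun g => ?_
      ext <;> simp [ofCoords, map_commutatorElement, ha, hb, hc, hcomm])

@[simp] lemma coordsEquiv_a : coordsEquiv a = ⟨1, 0, 0⟩ := toCoords_a
@[simp] lemma coordsEquiv_b : coordsEquiv b = ⟨0, 1, 0⟩ := toCoords_b

lemma mem_standardGenerators {s : HeisenbergGroup} :
    s ∈ standardGenerators ↔ s = a ∨ s = a⁻¹ ∨ s = b ∨ s = b⁻¹ := by
  simp [standardGenerators]

/-! ### Area bounds and exact word lengths -/

/-- The coordinates of the end point of a path confined to `-m ≤ x ≤ X`. -/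
lemma word_area_bound (w : List HeisenbergGroup) (hw : ∀ s ∈ w, s ∈ standardGenerators) :
    ∃ X m up dn hor : ℤ, 0 ≤ X ∧ 0 ≤ m ∧ 0 ≤ up ∧ 0 ≤ dn ∧
      (coordsEquiv w.prod).x ≤ X ∧ -m ≤ (coordsEquiv w.prod).x ∧
      (coordsEquiv w.prod).y = up - dn ∧ 2 * X + 2 * m - |(coordsEquiv w.prod).x| ≤ hor ∧
      (w.length : ℤ) = hor + up + dn ∧ (coordsEquiv w.prod).z ≤ up * X + dn * m := by
  induction w using List.reverseRecOn with
  | nil => exact ⟨0, 0, 0, 0, 0, by simp⟩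
  | append_singleton w s ih =>
    obtain ⟨X, m, up, dn, hor, hX, hm, hup, hdn, hxX, hmx, hy, hhor, hlen, hz⟩ :=
      ih fun t ht => hw t (by simp [ht])
    have hs := mem_standardGenerators.1 (hw s (by simp))
    generalize hg : coordsEquiv w.prod = g at *
    obtain ⟨x, y, z⟩ := g
    simp only [List.prod_append, List.prod_singleton, map_mul, hg, List.length_append,
      List.length_singleton, Nat.cast_add, Nat.cast_one, HeisenbergCoords.mul_x,
      HeisenbergCoords.mul_y, HeisenbergCoords.mul_z] at *
    rcases hs with rfl | rfl | rfl | rfl <;>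
      simp only [map_inv, coordsEquiv_a, coordsEquiv_b, HeisenbergCoords.inv_x,
        HeisenbergCoords.inv_y, HeisenbergCoords.inv_z, neg_zero, mul_zero, add_zero, mul_one,
        mul_neg]
    -- If x = X ≥ 0, then X and |x| both grow by 1, so 2X - |x| grows by 1; otherwise X stays and
    -- |x| changes by 1. The letter a⁻¹ is symmetric.
    · refine ⟨max X (x + 1), m, up, dn, hor + 1, ?_, hm, hup, hdn, ?_, ?_, hy, ?_, ?_, ?_⟩
      any_goals grind
      exact hz.trans (by gcongr; exact le_max_left _ _)
    · refine ⟨X, max m (1 - x), up, dn, hor + 1, hX, ?_, hup, hdn, ?_, ?_, hy, ?_, ?_, ?_⟩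
      any_goals grind
      exact hz.trans (by gcongr; exact le_max_left _ _)
    · exact ⟨X, m, up + 1, dn, hor, hX, hm, by omega, hdn, hxX, by omega, by omega, hhor,
        by omega, by linarith⟩
    · exact ⟨X, m, up, dn + 1, hor, hX, hm, hup, by omega, hxX, by omega, by omega, hhor,
        by omega, by linarith⟩

/-- A letter changes z by at most |x|, which is at most the length so far. This encloses the ball in
a box. -/
lemma word_coords_bound (w : List HeisenbergGroup) (hw : ∀ s ∈ w, s ∈ standardGenerators) :
    |(coordsEquiv w.prod).x| ≤ w.length ∧ |(coordsEquiv w.prod).y| ≤ w.length ∧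
      |(coordsEquiv w.prod).z| ≤ (w.length : ℤ) ^ 2 := by
  induction w using List.reverseRecOn with
  | nil => simp
  | append_singleton w s ih =>
    obtain ⟨hx, hy, hz⟩ := ih fun t ht => hw t (by simp [ht])
    have hs := mem_standardGenerators.1 (hw s (by simp))
    generalize hg : coordsEquiv w.prod = g at *
    obtain ⟨x, y, z⟩ := g
    simp only [List.prod_append, List.prod_singleton, map_mul, hg, List.length_append,
      List.length_singleton, Nat.cast_add, Nat.cast_one, HeisenbergCoords.mul_x,
      HeisenbergCoords.mul_y, HeisenbergCoords.mul_z] at *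
    rw [abs_le] at *
    have hsq : ((w.length : ℤ) + 1) ^ 2 = (w.length : ℤ) ^ 2 + 2 * w.length + 1 := by ring
    rw [abs_le, abs_le, hsq]
    rcases hs with rfl | rfl | rfl | rfl <;> simp <;> omega

/-- The word lengths of the elements `(x, y, q x - r)` with `y ≤ q ≤ x`. -/
lemma wordLength_eq {x y q r : ℕ} (hyq : y ≤ q) (hqx : q ≤ x) (hq : 1 ≤ q) (hr : r < x)
    {g : HeisenbergGroup} (hg : coordsEquiv g = ⟨x, y, q * x - r⟩) :
    wordLength standardGenerators g = x - y + 2 * q := by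
  have hmem : x - y + 2 * q ∈ {n : ℕ | ∃ w : List HeisenbergGroup,
      (∀ s ∈ w, s ∈ standardGenerators) ∧ w.prod = g ∧ w.length = n} := by
    -- The descent takes place at x = 0 and adds no area; the single b at abscissa x - r and the q -
    -- 1 later ones at x give (x - r) + (q - 1) x.
    refine ⟨List.replicate (q - y) b⁻¹ ++ List.replicate (x - r) a ++ [b] ++ List.replicate r a
      ++ List.replicate (q - 1) b, ?_, ?_, ?_⟩
    · intro s hs
      simp only [List.mem_append, List.mem_replicate, List.mem_singleton] at hs
      rw [mem_standardGenerators]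
      tauto
    · have ha (n : ℕ) : (⟨1, 0, 0⟩ : HeisenbergCoords) ^ n = ⟨n, 0, 0⟩ := by
        induction n with
        | zero => rfl
        | succ n ih => rw [pow_succ, ih]; ext <;> simp
      have hb (n : ℕ) : (⟨0, 1, 0⟩ : HeisenbergCoords) ^ n = ⟨0, n, 0⟩ := by
        induction n with
        | zero => rfl
        | succ n ih => rw [pow_succ, ih]; ext <;> simp
      apply coordsEquiv.injective
      rw [hg]
      simp only [List.prod_append, List.prod_replicate, List.prod_singleton, map_mul, map_pow,
        map_inv, coordsEquiv_a, coordsEquiv_b, ha, hb, inv_pow]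
      ext
      · simp; omega
      · simp; omega
      · simp
        push_cast [hr.le, hq]
        ring
    · simp; omega
  refine le_antisymm (Nat.sInf_le hmem) (le_csInf ⟨_, hmem⟩ ?_)
  rintro n ⟨w, hw, rfl, rfl⟩
  obtain ⟨X, m, up, dn, hor, hX, hm, hup, hdn, hxX, hmx, hy, hhor, hlen, hz⟩ :=
    word_area_bound w hw
  rw [hg] at *
  simp only [Nat.abs_cast] at *
  by_contra! hlt
  -- A shorter word has 2 (X + m) - x + 2 up - y < x - y + 2q; halve this.
  have hi : X + m - x + up ≤ q - 1 := by omega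
  have h1 : dn * m ≤ up * m := by gcongr; omega
  have h2 : up * (X + m) ≤ (q - 1 - (X + m - x)) * (X + m) := by
    apply mul_le_mul_of_nonneg_right <;> omega
  -- This product is (q - 1) x minus the bound in `h2`. Widening the path beyond x thus gains
  -- nothing: z ≤ (q - 1) x < q x - r.
  have h3 : 0 ≤ (X + m - x) * (X + m - (q - 1)) := by apply mul_nonneg <;> omega
  have h4 : (r : ℤ) < x := by exact_mod_cast hr
  nlinarith

/-! ### Curvature from the residue -/

lemma averageConjLength_eq (g : HeisenbergGroup) :
    averageConjLength standardGenerators g =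
      ((wordLength standardGenerators (a⁻¹ * g * a) : ℝ) +
        wordLength standardGenerators (a * g * a⁻¹) +
        wordLength standardGenerators (b⁻¹ * g * b) +
        wordLength standardGenerators (b * g * b⁻¹)) / 4 := by
  have hne {g h : HeisenbergGroup} (hgh : coordsEquiv g ≠ coordsEquiv h) : g ≠ h :=
    fun e => hgh (e ▸ rfl)
  have h1 : a ≠ a⁻¹ := hne (by simp [HeisenbergCoords.ext_iff])
  have h2 : a ≠ b := hne (by simp)
  have h3 : a ≠ b⁻¹ := hne (by simp [HeisenbergCoords.ext_iff])
  have h4 : a⁻¹ ≠ b := hne (by simp [HeisenbergCoords.ext_iff])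
  have h5 : a⁻¹ ≠ b⁻¹ := hne (by simp [HeisenbergCoords.ext_iff])
  have h6 : b ≠ b⁻¹ := hne (by simp [HeisenbergCoords.ext_iff])
  classical
  have hcard : standardGenerators.card = 4 := by
    rw [standardGenerators, Finset.card_insert_of_notMem, Finset.card_insert_of_notMem,
      Finset.card_insert_of_notMem, Finset.card_singleton] <;> simp [*, -inv_inj]
  have hsum (f : HeisenbergGroup → ℝ) :
      ∑ s ∈ standardGenerators, f s = f a + (f a⁻¹ + (f b + f b⁻¹)) := by
    rw [standardGenerators, Finset.sum_insert, Finset.sum_insert, Finset.sum_insert,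
      Finset.sum_singleton] <;> simp [*, -inv_inj]
  rw [averageConjLength, hcard, hsum]
  simp only [inv_inv]
  push_cast
  ring

/-- The curvature of `(x, y, q x - r)` is governed by the residue `r`. -/
lemma curvature_eq {x y q r : ℕ} (hyq : y + 1 ≤ q) (hq : 2 ≤ q) (hqx : q + 1 ≤ x) (hr : r < x)
    {g : HeisenbergGroup} (hg : coordsEquiv g = ⟨x, y, q * x - r⟩) :
    curvature g = ((if x ≤ r + y then 1 else 0) - (if r < y then 1 else 0)) / 2 /
      (x - y + 2 * q : ℕ) := by
  have h0 := wordLength_eq (by omega) (by omega) (by omega) hr hg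
  -- Here z drops by y, so r becomes r + y; on reaching x it wraps around and q drops by 1.
  have h1 : wordLength standardGenerators (a⁻¹ * g * a) + (if x ≤ r + y then 2 else 0) =
      x - y + 2 * q := by
    split_ifs with h
    · rw [wordLength_eq (x := x) (y := y) (q := q - 1) (r := r + y - x)]
      any_goals omega
      simp only [map_mul, map_inv, hg, coordsEquiv_a]
      ext <;> simp
      push_cast [h, (by omega : 1 ≤ q)]
      ring
    · rw [wordLength_eq (x := x) (y := y) (q := q) (r := r + y)]
      any_goals omega
      simp only [map_mul, map_inv, hg, coordsEquiv_a]
      ext <;> simp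
      ring
  have h2 : wordLength standardGenerators (a * g * a⁻¹) =
      x - y + 2 * q + (if r < y then 2 else 0) := by
    split_ifs with h
    · rw [wordLength_eq (x := x) (y := y) (q := q + 1) (r := r + x - y)]
      any_goals omega
      simp only [map_mul, map_inv, hg, coordsEquiv_a]
      ext <;> simp
      push_cast [(by omega : y ≤ r + x)]
      ring
    · rw [wordLength_eq (x := x) (y := y) (q := q) (r := r - y)]
      any_goals omega
      simp only [map_mul, map_inv, hg, coordsEquiv_a]
      ext <;> simp
      push_cast [(by omega : y ≤ r)]
      ring
  have h3 : wordLength standardGenerators (b⁻¹ * g * b) = x - y + 2 * q + 2 := by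
    rw [wordLength_eq (x := x) (y := y) (q := q + 1) (r := r)]
    any_goals omega
    simp only [map_mul, map_inv, hg, coordsEquiv_b]
    ext <;> simp
    ring
  have h4 : wordLength standardGenerators (b * g * b⁻¹) + 2 = x - y + 2 * q := by
    rw [wordLength_eq (x := x) (y := y) (q := q - 1) (r := r)]
    any_goals omega
    simp only [map_mul, map_inv, hg, coordsEquiv_b]
    ext <;> simp
    push_cast [(by omega : 1 ≤ q)]
    ring
  rw [curvature, comparisonCurvature, averageConjLength_eq, h0, h2, h3]
  generalize x - y + 2 * q = L at *
  have h1' := congrArg (Nat.cast (R := ℝ)) h1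
  have h4' := congrArg (Nat.cast (R := ℝ)) h4
  congr 1
  push_cast at h1' h4' ⊢
  split_ifs at * <;> linarith

/-! ### Counting in the ball -/

lemma exists_word (g : HeisenbergGroup) :
    ∃ w : List HeisenbergGroup, (∀ s ∈ w, s ∈ standardGenerators) ∧ w.prod = g ∧
      w.length = wordLength standardGenerators g := by
  -- The infimum is attained once some word represents g; for an empty set it would take the default
  -- value 0.
  refine Nat.sInf_mem (s := {n : ℕ | ∃ w : List HeisenbergGroup,
      (∀ s ∈ w, s ∈ standardGenerators) ∧ w.prod = g ∧ w.length = n}) ?_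
  have hg : g ∈ Subgroup.closure (Set.range (PresentedGroup.of (rels := heisenbergRelators))) := by
    rw [PresentedGroup.closure_range_of]
    trivial
  rw [← Subgroup.mem_toSubmonoid, Subgroup.closure_toSubmonoid] at hg
  obtain ⟨w, hw, rfl⟩ := Submonoid.exists_list_of_mem_closure hg
  refine ⟨_, w, fun s hs => ?_, rfl, rfl⟩
  have hof (i : Fin 2) : PresentedGroup.of (rels := heisenbergRelators) i = a ∨
      PresentedGroup.of (rels := heisenbergRelators) i = b := by
    fin_cases i
    · exact Or.inl rfl
    · exact Or.inr rfl
  rw [mem_standardGenerators]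
  rcases hw s hs with ⟨i, hi⟩ | ⟨i, hi⟩
  · rcases hof i with h | h <;> rw [← hi, h] <;> simp
  · rw [← inv_eq_iff_eq_inv.2 hi]
    rcases hof i with h | h <;> rw [h] <;> simp

lemma wordBall_finite_and_ncard_le (n : ℕ) :
    (wordBall standardGenerators n).Finite ∧
      (wordBall standardGenerators n).ncard ≤ (2 * n + 1) ^ 2 * (2 * n ^ 2 + 1) := by
  classical
  let box : Finset (ℤ × ℤ × ℤ) := Finset.Icc (-n : ℤ) n ×ˢ Finset.Icc (-n : ℤ) n ×ˢ
    Finset.Icc (-(n : ℤ) ^ 2) ((n : ℤ) ^ 2)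
  let f : ℤ × ℤ × ℤ → HeisenbergGroup := fun p => coordsEquiv.symm ⟨p.1, p.2.1, p.2.2⟩
  have hsub : wordBall standardGenerators n ⊆ (box.image f : Finset HeisenbergGroup) := by
    intro g hg
    obtain ⟨w, hw, rfl, hlen⟩ := exists_word g
    obtain ⟨hx, hy, hz⟩ := word_coords_bound w hw
    have hn : (w.length : ℤ) ≤ n := by rw [hlen]; exact_mod_cast hg
    have hn2 : (w.length : ℤ) ^ 2 ≤ (n : ℤ) ^ 2 := by gcongr
    rw [Finset.coe_image]
    refine ⟨((coordsEquiv w.prod).x, (coordsEquiv w.prod).y, (coordsEquiv w.prod).z), ?_,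
      coordsEquiv.symm_apply_apply _⟩
    simp only [box, Finset.coe_product, Finset.coe_Icc, Set.mem_prod, Set.mem_Icc, ← abs_le]
    exact ⟨hx.trans hn, hy.trans hn, hz.trans hn2⟩
  refine ⟨(Finset.finite_toSet _).subset hsub, ?_⟩
  calc (wordBall standardGenerators n).ncard
      ≤ (box.image f).card := by
        rw [← Set.ncard_coe_finset]
        exact Set.ncard_le_ncard hsub (Finset.finite_toSet _)
    _ ≤ box.card := Finset.card_image_le
    _ = _ := by
        simp only [box, Finset.card_product, Int.card_Icc]
        have h1 : ((n : ℤ) + 1 - -n).toNat = 2 * n + 1 := by omega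
        have h2 : ((n : ℤ) ^ 2 + 1 - -(n : ℤ) ^ 2).toNat = 2 * n ^ 2 + 1 := by
          rw [← Nat.cast_pow]
          omega
        rw [h1, h2]
        ring

/-- A family of `m ^ 4` elements of the ball of radius `n`, parametrized by `x`, `y`, `q` and the
residue `ρ x t`. -/
lemma pow_four_le_ncard {m n : ℕ} (hmn : 15 * m ≤ n) {P : HeisenbergGroup → Prop}
    (ρ : ℕ → ℕ → ℕ) (hρ : ∀ x t, 8 * m ≤ x → t < m → ρ x t < x)
    (hinj : ∀ x t t', 8 * m ≤ x → t < m → t' < m → ρ x t = ρ x t' → t = t')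
    (hP : ∀ x y q t g, 8 * m ≤ x → m ≤ y → y < 2 * m → y + 1 ≤ q → 2 ≤ q → q + 1 ≤ x → t < m →
      coordsEquiv g = ⟨x, y, q * x - ρ x t⟩ → P g) :
    m ^ 4 ≤ {g | g ∈ wordBall standardGenerators n ∧ P g}.ncard := by
  let s : Finset (ℕ × ℕ × ℕ × ℕ) :=
    Finset.range m ×ˢ Finset.range m ×ˢ Finset.range m ×ˢ Finset.range m
  -- With x in [8m, 9m), y in [m, 2m) and q in [2m + 1, 3m], one has y < q < x and length below 14m.
  let f : ℕ × ℕ × ℕ × ℕ → HeisenbergGroup := fun p =>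
    coordsEquiv.symm ⟨(8 * m + p.1 : ℕ), (m + p.2.1 : ℕ),
      (2 * m + 1 + p.2.2.1 : ℕ) * (8 * m + p.1 : ℕ) - ρ (8 * m + p.1) p.2.2.2⟩
  have hs : (s : Set (ℕ × ℕ × ℕ × ℕ)).ncard = m ^ 4 := by
    rw [Set.ncard_coe_finset]
    simp only [s, Finset.card_product, Finset.card_range]
    ring
  rw [← hs]
  refine Set.ncard_le_ncard_of_injOn f ?_ ?_
    ((wordBall_finite_and_ncard_le n).1.subset fun g hg => hg.1)
  · rintro ⟨i, j, k, t⟩ h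
    simp only [s, Finset.coe_product, Finset.coe_range, Set.mem_prod, Set.mem_Iio] at h
    have hf : coordsEquiv (f (i, j, k, t)) = ⟨(8 * m + i : ℕ), (m + j : ℕ),
      (2 * m + 1 + k : ℕ) * (8 * m + i : ℕ) - ρ (8 * m + i) t⟩ := coordsEquiv.apply_symm_apply _
    refine ⟨?_, hP _ _ _ t _ ?_ ?_ ?_ ?_ ?_ ?_ h.2.2.2 hf⟩
    any_goals omega
    change wordLength _ _ ≤ n
    rw [wordLength_eq (by omega) (by omega) (by omega) (hρ _ _ (by omega) h.2.2.2) hf]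
    omega
  · rintro ⟨i, j, k, t⟩ h ⟨i', j', k', t'⟩ h' heq
    simp only [s, Finset.coe_product, Finset.coe_range, Set.mem_prod, Set.mem_Iio] at h h'
    have heq := coordsEquiv.symm.injective heq
    simp only [HeisenbergCoords.mk.injEq, Nat.cast_inj] at heq
    obtain ⟨hx, hy, hz⟩ := heq
    obtain rfl : i = i' := by omega
    obtain rfl : j = j' := by omega
    have hr := hρ (8 * m + i) t (by omega) h.2.2.2
    have hr' := hρ (8 * m + i) t' (by omega) h'.2.2.2
    have hmx : 8 * m ≤ 8 * m + i := by omega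
    generalize 8 * m + i = x at *
    -- For fixed x, z = q x - r lies in ((q - 1) x, q x]; these intervals are disjoint for distinct
    -- q.
    have hk : k = k' := by
      rcases lt_trichotomy k k' with hlt | heq | hlt
      · have : (2 * m + 1 + k + 1) * x ≤ (2 * m + 1 + k') * x :=
          Nat.mul_le_mul_right x (by omega)
        zify at this hr hr'
        push_cast at hz
        linarith
      · exact heq
      · have : (2 * m + 1 + k' + 1) * x ≤ (2 * m + 1 + k) * x :=
          Nat.mul_le_mul_right x (by omega)
        zify at this hr hr'
        push_cast at hz
        linarith
    subst hk
    obtain rfl : t = t' := hinj x t t' hmx h.2.2.2 h'.2.2.2 (by omega)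
    rfl

/-- The ball has at most 27 n^4 elements and m ≥ n / 30, so the proportion is at least 1 / (27 ·
30^4) > 1 / 30^5. -/
lemma lt_ballProportion {m n : ℕ} (hn : 15 ≤ n) (hm : n ≤ 30 * m) {P : HeisenbergGroup → Prop}
    (h : m ^ 4 ≤ {g | g ∈ wordBall standardGenerators n ∧ P g}.ncard) :
    1 / 30 ^ 5 < ballProportion standardGenerators P n := by
  obtain ⟨hfin, hball⟩ := wordBall_finite_and_ncard_le n
  have hle := Set.ncard_le_ncard (s := {g | g ∈ wordBall standardGenerators n ∧ P g})
    (fun g hg => hg.1) hfin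
  have hm4 : n ^ 4 ≤ (30 * m) ^ 4 := by gcongr
  have hn4 : 0 < n ^ 4 := by positivity
  have hb : (2 * n + 1) ^ 2 * (2 * n ^ 2 + 1) ≤ 27 * n ^ 4 := by
    calc (2 * n + 1) ^ 2 * (2 * n ^ 2 + 1) ≤ (3 * n) ^ 2 * (3 * n ^ 2) := by
          gcongr
          · omega
          · nlinarith
      _ = _ := by ring
  rw [ballProportion]
  generalize {g | g ∈ wordBall standardGenerators n ∧ P g}.ncard = A at *
  generalize (wordBall standardGenerators n).ncard = B at *
  have hmpow : (30 * m) ^ 4 = 30 ^ 4 * m ^ 4 := by ring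
  have hB : 0 < B := by omega
  rw [div_lt_div_iff₀ (by positivity) (by exact_mod_cast hB), one_mul]
  have : B < A * 30 ^ 5 := by omega
  exact_mod_cast this

lemma ballProportion_add_le_one {P Q : HeisenbergGroup → Prop} (hPQ : ∀ g, P g → ¬ Q g) (n : ℕ) :
    ballProportion standardGenerators P n + ballProportion standardGenerators Q n ≤ 1 := by
  have hfin := (wordBall_finite_and_ncard_le n).1
  rw [ballProportion, ballProportion, ← add_div]
  refine div_le_one_of_le₀ ?_ (by positivity)
  rw [← Nat.cast_add, ← Set.ncard_union_eq
    (Set.disjoint_left.2 fun g hg hg' => hPQ g hg.2 hg'.2)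
    (hfin.subset (Set.sep_subset _ _)) (hfin.subset (Set.sep_subset _ _))]
  exact_mod_cast Set.ncard_le_ncard
    (Set.union_subset (Set.sep_subset _ _) (Set.sep_subset _ _)) hfin

end HeisenbergGroup

theorem mainTheorem4 :
    ∃ ε : ℝ, 0 < ε ∧ ∃ N : ℕ, ∀ n : ℕ, N ≤ n →
      (ε < ballProportion HeisenbergGroup.standardGenerators
            (fun g => HeisenbergGroup.curvature g = 0) n ∧
        ballProportion HeisenbergGroup.standardGenerators
            (fun g => HeisenbergGroup.curvature g = 0) n < 1 - ε) ∧
      (ε < ballProportion HeisenbergGroup.standardGenerators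
            (fun g => 0 < HeisenbergGroup.curvature g) n ∧
        ballProportion HeisenbergGroup.standardGenerators
            (fun g => 0 < HeisenbergGroup.curvature g) n < 1 - ε) ∧
      (ε < ballProportion HeisenbergGroup.standardGenerators
            (fun g => HeisenbergGroup.curvature g < 0) n ∧
        ballProportion HeisenbergGroup.standardGenerators
            (fun g => HeisenbergGroup.curvature g < 0) n < 1 - ε) := by
  refine ⟨1 / 30 ^ 5, by positivity, 15, fun n hn => ?_⟩
  have hmn : 15 * (n / 15) ≤ n := by omega
  have hnm : n ≤ 30 * (n / 15) := by omega
  have hzero : 1 / 30 ^ 5 < ballProportion HeisenbergGroup.standardGenerators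
      (fun g => HeisenbergGroup.curvature g = 0) n := by
    -- With m = n / 15, the residues in [2m, 3m) satisfy y ≤ r and r + y < 5m ≤ x: no wrap-around.
    refine HeisenbergGroup.lt_ballProportion hn hnm (HeisenbergGroup.pow_four_le_ncard hmn
      (fun _ t => 2 * (n / 15) + t) (by omega) (by omega) ?_)
    intro x y q t g hx hy hy' hyq hq hqx ht hg
    rw [HeisenbergGroup.curvature_eq hyq hq hqx (by omega) hg, if_neg (by omega),
      if_neg (by omega)]
    simp
  have hpos : 1 / 30 ^ 5 < ballProportion HeisenbergGroup.standardGenerators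
      (fun g => 0 < HeisenbergGroup.curvature g) n := by
    -- The top m residues satisfy r + y ≥ x because y ≥ m: only the upward shift wraps.
    refine HeisenbergGroup.lt_ballProportion hn hnm (HeisenbergGroup.pow_four_le_ncard hmn
      (fun x t => x - 1 - t) (by omega) (by omega) ?_)
    intro x y q t g hx hy hy' hyq hq hqx ht hg
    have hL : (0 : ℝ) < (x - y + 2 * q : ℕ) := by exact_mod_cast (by omega)
    rw [HeisenbergGroup.curvature_eq hyq hq hqx (by omega) hg, if_pos (by omega),
      if_neg (by omega), sub_zero]
    positivity
  have hneg : 1 / 30 ^ 5 < ballProportion HeisenbergGroup.standardGenerators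
      (fun g => HeisenbergGroup.curvature g < 0) n := by
    -- Residues below m ≤ y: only the downward shift wraps.
    refine HeisenbergGroup.lt_ballProportion hn hnm (HeisenbergGroup.pow_four_le_ncard hmn
      (fun _ t => t) (by omega) (by omega) ?_)
    intro x y q t g hx hy hy' hyq hq hqx ht hg
    have hL : (0 : ℝ) < (x - y + 2 * q : ℕ) := by exact_mod_cast (by omega)
    rw [HeisenbergGroup.curvature_eq hyq hq hqx (by omega) hg, if_neg (by omega),
      if_pos (by omega)]
    exact div_neg_of_neg_of_pos (by norm_num) hL
  have h1 := HeisenbergGroup.ballProportion_add_le_one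
    (P := fun g => HeisenbergGroup.curvature g = 0) (Q := fun g => 0 < HeisenbergGroup.curvature g)
    (fun g h => by simp [h]) n
  have h2 := HeisenbergGroup.ballProportion_add_le_one
    (P := fun g => HeisenbergGroup.curvature g < 0) (Q := fun g => 0 < HeisenbergGroup.curvature g)
    (fun g h => not_lt.2 h.le) n
  refine ⟨⟨hzero, ?_⟩, ⟨hpos, ?_⟩, ⟨hneg, ?_⟩⟩ <;> linarith
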